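/- Let $q$ be an indeterminate. For a permutation $\pi$ of $\{1,\dots,n\}$, let $\mathrm{Des}(\pi)=\{i: 1\le i<n,\ \pi(i)>\pi(i+1)\}$ be its descent set, $\mathrm{des}(\pi)=|\mathrm{Des}(\pi)|$ its number of descents, and $\mathrm{maj}(\pi)=\sum_{i\in\mathrm{Des}(\pi)} i$ its major index. Let $\mathcal I_n(321)$ be the set of involutions $\pi=\pi^{-1}$ of $\{1,\dots,n\}$ that are $321$-avoiding, i.e. for which there are no $i<j<l$ with $\pi(i)>\pi(j)>\pi(l)$. The $q$-binomial coefficients are $$\binom{m}{j}_q=\frac{(1-q^m)(1-q^{m-1})\cdots(1-q^{m-j+1})}{(1-q^j)(1-q^{j-1})\cdots(1-q)},$$ which is $0$ when $j>m$. Then for all integers $0\le k<n$, $$\sum_{\substack{\pi\in\mathcal I_n(321)\\ \mathrm{des}(\pi)=k}} q^{\mathrm{maj}(\pi)} = q^{k^2}\binom{\lceil n/2\rceil}{k}_q\binom{\lfloor n/2\rfloor}{k}_q.$$ -/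

import Mathlib

namespace PermStat

/-- `π` is 321-avoiding: there are no `i < j < k` with `π i > π j > π k`. -/
def Avoids321 {n : ℕ} (π : Equiv.Perm (Fin n)) : Prop :=
  ¬ ∃ i j k : Fin n, i < j ∧ j < k ∧ π i > π j ∧ π j > π k

instance {n : ℕ} (π : Equiv.Perm (Fin n)) : Decidable (Avoids321 π) := by
  unfold Avoids321
  infer_instance

/-- The 321-avoiding involutions of an `n`-element chain. -/
def involutions321 (n : ℕ) : Finset (Equiv.Perm (Fin n)) :=
  Finset.univ.filter fun π => π = π⁻¹ ∧ Avoids321 π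

/-- The set of descent positions `1 ≤ i < n`. Positions are numbered from `1` to `n`, so the
positions `i` and `i + 1` are the elements `a` and `b` of `Fin n` with values `i - 1` and `i`. -/
def descentSet {n : ℕ} (π : Equiv.Perm (Fin n)) : Finset ℕ :=
  (Finset.Ico 1 n).filter fun i =>
    ∃ a b : Fin n, (a : ℕ) + 1 = i ∧ (b : ℕ) = i ∧ π a > π b

/-- The number of descents. -/
def des {n : ℕ} (π : Equiv.Perm (Fin n)) : ℕ := (descentSet π).card

/-- The major index: the sum of the descent positions. -/
def maj {n : ℕ} (π : Equiv.Perm (Fin n)) : ℕ := ∑ i ∈ descentSet π, i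

/-- The `q`-binomial coefficient
`(1 - q^m)(1 - q^(m-1)) ⋯ (1 - q^(m-j+1)) / ((1 - q^j)(1 - q^(j-1)) ⋯ (1 - q))`,
where `q = RatFunc.X` is the indeterminate of `ℚ(q)`. No factor of the denominator vanishes; if
`j > m`, the numerator has the factor `1 - q^0 = 0`. -/
noncomputable def qBinomial (m j : ℕ) : RatFunc ℚ :=
  (∏ i ∈ Finset.range j, (1 - RatFunc.X ^ (m - i))) /
    ∏ i ∈ Finset.range j, (1 - RatFunc.X ^ (i + 1))

end PermStat

/-! Mark each position of a 321-avoiding involution as an opener (`π i > i`), a closer (`π i < i`)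
or a fixed point. Avoiding 321 forbids nested arcs and fixed points under an arc, so openers and
closers are matched in order and the word of marks determines `π`. The words that arise are the
ballot words ending at height 0 whose zeros all lie at height 0, and the descents are exactly the
peaks, an opener followed by a closer (`sum_involutions321_eq_wordGF`).

To count these words by peaks, let the final height `h` vary. Deleting the last letter, or the last
two when they form a peak, gives a recursion for `wordGF`. Its solution is `q^(k²) [⌈(n+h)/2⌉, k]
[⌊(n-h)/2⌋, k]` (`wordGF_eq`), because this product satisfies the same recursion: multiply two
instances of the `q`-Pascal rule (`qBinomialProd_succ`). The theorem is the case `h = 0`. -/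

namespace PermStat

/-! ### The `q`-binomial side -/

theorem qBinomial_zero_right (m : ℕ) : qBinomial m 0 = 1 := by
  simp [qBinomial]

theorem qBinomial_zero_succ (k : ℕ) : qBinomial 0 (k + 1) = 0 := by
  simp [qBinomial]

theorem one_sub_X_pow_ne_zero (i : ℕ) : (1 - RatFunc.X ^ (i + 1) : RatFunc ℚ) ≠ 0 := by
  intro h
  have h1 : algebraMap (Polynomial ℚ) (RatFunc ℚ) (1 - Polynomial.X ^ (i + 1)) = 0 := by
    simpa using h
  rw [map_eq_zero_iff _ (RatFunc.algebraMap_injective ℚ)] at h1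
  have h2 := congrArg (Polynomial.eval 0) h1
  simp at h2

/-- A form of the `q`-Pascal rule without subtraction of exponents. -/
theorem qBinomial_succ_sub (m k : ℕ) :
    RatFunc.X ^ k * (qBinomial (m + 1) (k + 1) - qBinomial m (k + 1)) =
      RatFunc.X ^ m * qBinomial m k := by
  have hd : (∏ i ∈ Finset.range k, (1 - RatFunc.X ^ (i + 1) : RatFunc ℚ)) ≠ 0 :=
    Finset.prod_ne_zero_iff.2 fun i _ => one_sub_X_pow_ne_zero i
  have hk := one_sub_X_pow_ne_zero k
  have h1 : (∏ i ∈ Finset.range (k + 1), (1 - RatFunc.X ^ (m + 1 - i) : RatFunc ℚ)) =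
      (∏ i ∈ Finset.range k, (1 - RatFunc.X ^ (m - i))) * (1 - RatFunc.X ^ (m + 1)) := by
    rw [Finset.prod_range_succ']
    simp
  unfold qBinomial
  rw [h1, Finset.prod_range_succ, Finset.prod_range_succ]
  rcases le_or_gt k m with hkm | hkm
  · obtain ⟨j, rfl⟩ := Nat.exists_eq_add_of_le hkm
    rw [Nat.add_sub_cancel_left]
    field_simp
    ring
  -- The factor at `i = m` is `1 - q^0 = 0`.
  · have h0 : (∏ i ∈ Finset.range k, (1 - RatFunc.X ^ (m - i) : RatFunc ℚ)) = 0 :=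
      Finset.prod_eq_zero (Finset.mem_range.2 hkm) (by simp)
    simp [h0]

/-- The product of `q`-binomials `q^(k²) [a, k] [b, k]`. -/
noncomputable def qBinomialProd (k a b : ℕ) : RatFunc ℚ :=
  RatFunc.X ^ (k ^ 2) * qBinomial a k * qBinomial b k

theorem qBinomialProd_comm (k a b : ℕ) : qBinomialProd k a b = qBinomialProd k b a := by
  unfold qBinomialProd
  ring

theorem qBinomialProd_zero (a b : ℕ) : qBinomialProd 0 a b = 1 := by
  simp [qBinomialProd, qBinomial_zero_right]

theorem qBinomialProd_succ_zero_right (k a : ℕ) : qBinomialProd (k + 1) a 0 = 0 := by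
  simp [qBinomialProd, qBinomial_zero_succ]

/-- The mixed second difference in `a` and `b` factors into two first differences, and each is given
by `q`-Pascal. The exponents add up to `(k+1)² + (a-k) + (b-k) = k² + a + b + 1`. -/
theorem qBinomialProd_succ (k a b : ℕ) :
    qBinomialProd (k + 1) (a + 1) (b + 1) =
      qBinomialProd (k + 1) a (b + 1) + (RatFunc.X ^ (a + b + 1) * qBinomialProd k a b +
        (qBinomialProd (k + 1) (a + 1) b - qBinomialProd (k + 1) a b)) := by
  have ha := qBinomial_succ_sub a k
  have hb := qBinomial_succ_sub b k
  have h := congrArg₂ (· * ·) ha hb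
  unfold qBinomialProd
  have e : (RatFunc.X : RatFunc ℚ) ^ ((k + 1) ^ 2) =
      RatFunc.X ^ (k ^ 2) * RatFunc.X * RatFunc.X ^ k * RatFunc.X ^ k := by ring
  rw [e]
  linear_combination (RatFunc.X ^ (k ^ 2) * RatFunc.X) * h

/-! ### Words with openers `1`, closers `-1` and fixed points `0` -/

/-- The words (last letter first) of length `n` which end at height `h`, never go below height `0`
and have zeros only at height `0`. -/
def words : ℕ → ℕ → Finset (List SignType)
  | 0, 0 => {[]}
  | 0, _ + 1 => ∅
  | n + 1, 0 => (words n 1).image (List.cons (-1)) ∪ (words n 0).image (List.cons 0)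
  | n + 1, h + 1 => (words n (h + 2)).image (List.cons (-1)) ∪ (words n h).image (List.cons 1)

/-- The number of peaks of a word. -/
def wordDes : List SignType → ℕ
  | [] => 0
  | x :: w => wordDes w + if x = -1 ∧ w.head? = some 1 then 1 else 0

/-- The sum of the positions of the peaks of a word. -/
def wordMaj : List SignType → ℕ
  | [] => 0
  | x :: w => wordMaj w + if x = -1 ∧ w.head? = some 1 then w.length else 0

theorem length_of_mem_words {n h : ℕ} {w : List SignType} (hw : w ∈ words n h) :
    w.length = n := by
  induction n generalizing h w with
  | zero => cases h <;> simp_all [words]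
  | succ n ih =>
    cases h <;> simp only [words, Finset.mem_union, Finset.mem_image] at hw <;>
    · rcases hw with ⟨v, hv, rfl⟩ | ⟨v, hv, rfl⟩ <;> simp [ih hv]

/-- The contribution of a word to the generating function of the words with `k` peaks. -/
noncomputable def wordWeight (k : ℕ) (w : List SignType) : RatFunc ℚ :=
  if wordDes w = k then RatFunc.X ^ wordMaj w else 0

/-- The generating function of `words n h`, restricted to the words with `k` peaks. -/
noncomputable def wordGF (n h k : ℕ) : RatFunc ℚ := ∑ w ∈ words n h, wordWeight k w

/-- The generating function of the words of length `n + 1`, height `h` and last letter `-1`. -/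
noncomputable def closedGF (n h k : ℕ) : RatFunc ℚ :=
  ∑ w ∈ words n (h + 1), wordWeight k (-1 :: w)

/-! ### Recursions from deleting the last letters -/

theorem wordWeight_cons {x : SignType} (hx : x ≠ -1) (k : ℕ) (w : List SignType) :
    wordWeight k (x :: w) = wordWeight k w := by
  simp [wordWeight, wordDes, wordMaj, hx]

theorem sum_image_cons (x : SignType) (s : Finset (List SignType))
    (g : List SignType → RatFunc ℚ) :
    ∑ w ∈ s.image (List.cons x), g w = ∑ w ∈ s, g (x :: w) :=
  Finset.sum_image fun _ _ _ _ h => (List.cons.inj h).2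

theorem disjoint_image_cons {x y : SignType} (hxy : x ≠ y) (s t : Finset (List SignType)) :
    Disjoint (s.image (List.cons x)) (t.image (List.cons y)) := by
  rw [Finset.disjoint_left]
  intro w h1 h2
  rw [Finset.mem_image] at h1 h2
  obtain ⟨a, -, rfl⟩ := h1
  obtain ⟨b, -, hb⟩ := h2
  exact hxy (List.cons.inj hb).1.symm

theorem sum_words_succ_succ (n h : ℕ) (g : List SignType → RatFunc ℚ) :
    ∑ w ∈ words (n + 1) (h + 1), g w =
      ∑ w ∈ words n (h + 2), g (-1 :: w) + ∑ w ∈ words n h, g (1 :: w) := by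
  rw [words, Finset.sum_union (disjoint_image_cons (by decide) _ _), sum_image_cons,
    sum_image_cons]

theorem wordGF_succ_succ (n h k : ℕ) :
    wordGF (n + 1) (h + 1) k = wordGF n h k + closedGF n (h + 1) k := by
  rw [wordGF, sum_words_succ_succ, add_comm]
  simp only [wordWeight_cons (show (1 : SignType) ≠ -1 by decide)]
  rfl

theorem wordGF_succ_zero (n k : ℕ) :
    wordGF (n + 1) 0 k = wordGF n 0 k + closedGF n 0 k := by
  rw [wordGF, words, Finset.sum_union (disjoint_image_cons (by decide) _ _), sum_image_cons,
    sum_image_cons, add_comm]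
  simp only [wordWeight_cons (show (0 : SignType) ≠ -1 by decide)]
  rfl

theorem closedGF_zero (h k : ℕ) : closedGF 0 h k = 0 := by
  simp [closedGF, words]

theorem wordWeight_closed_closed (k : ℕ) (w : List SignType) :
    wordWeight k (-1 :: -1 :: w) = wordWeight k (-1 :: w) := by
  simp [wordWeight, wordDes, wordMaj]

/-- A closer after a closer makes no new peak, and the words ending in a closer are all words minus
those ending in an opener. -/
theorem sum_closed_closed (n h k : ℕ) :
    ∑ w ∈ words n (h + 2), wordWeight k (-1 :: -1 :: w) =
      wordGF (n + 1) (h + 1) k - wordGF n h k := by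
  rw [wordGF_succ_succ, add_sub_cancel_left]
  simp only [wordWeight_closed_closed]
  rfl

theorem closedGF_succ_zero (n h : ℕ) :
    closedGF (n + 1) h 0 = wordGF (n + 1) (h + 1) 0 - wordGF n h 0 := by
  rw [closedGF, sum_words_succ_succ, sum_closed_closed]
  simp [wordWeight, wordDes]

/-- The letter before the final closer is at positive height, so it is no fixed point. An opener
there creates a peak at position `n + 1`; a closer creates none. -/
theorem closedGF_succ_succ (n h k : ℕ) :
    closedGF (n + 1) h (k + 1) = RatFunc.X ^ (n + 1) * wordGF n h k +
      (wordGF (n + 1) (h + 1) (k + 1) - wordGF n h (k + 1)) := by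
  rw [closedGF, sum_words_succ_succ, sum_closed_closed, add_comm]
  congr 1
  rw [wordGF, Finset.mul_sum]
  refine Finset.sum_congr rfl fun w hw => ?_
  have hl := length_of_mem_words hw
  by_cases hd : wordDes w = k
  · simp [wordWeight, wordDes, wordMaj, hd, hl, pow_add]
    ring
  · simp [wordWeight, wordDes, hd]

theorem wordGF_zero_zero (k : ℕ) : wordGF 0 0 k = qBinomialProd k 0 0 := by
  cases k
  · simp [wordGF, words, wordWeight, wordDes, wordMaj, qBinomialProd_zero]
  · simp [wordGF, words, wordWeight, wordDes, qBinomialProd_succ_zero_right]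

theorem wordGF_of_lt {n h : ℕ} (hn : n < h) (k : ℕ) : wordGF n h k = 0 := by
  suffices words n h = ∅ by simp [wordGF, this]
  induction n generalizing h with
  | zero =>
    cases h with
    | zero => omega
    | succ h => rfl
  | succ n ih =>
    cases h with
    | zero => omega
    | succ h => simp [words, ih (show n < h + 2 by omega), ih (show n < h by omega)]

theorem qBinomialProd_zero_right (k a a' : ℕ) : qBinomialProd k a 0 = qBinomialProd k a' 0 := by
  cases k
  · rw [qBinomialProd_zero, qBinomialProd_zero]
  · rw [qBinomialProd_succ_zero_right, qBinomialProd_succ_zero_right]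

theorem closedGF_of_le {n h : ℕ} (hn : n ≤ h) (k : ℕ) : closedGF n h k = 0 := by
  cases n with
  | zero => exact closedGF_zero h k
  | succ n =>
    cases k with
    | zero => rw [closedGF_succ_zero, wordGF_of_lt (by omega), wordGF_of_lt (by omega), sub_zero]
    | succ k =>
      rw [closedGF_succ_succ, wordGF_of_lt (by omega), wordGF_of_lt (by omega),
        wordGF_of_lt (by omega)]
      simp

theorem wordGF_eq {n h : ℕ} (hn : h ≤ n) (k : ℕ) :
    wordGF n h k = qBinomialProd k ((n + h + 1) / 2) ((n - h) / 2) := by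
  induction n using Nat.strong_induction_on generalizing h k with
  | _ n ih =>
  rcases n with _ | n
  · obtain rfl : h = 0 := by omega
    exact wordGF_zero_zero k
  -- Deleting a final fixed point (`h = 0`) or a final opener (`h > 0`) yields the same product,
  -- thanks to the symmetry in the two arguments.
  have hstep : wordGF (n + 1) h k =
      qBinomialProd k ((n + h) / 2) ((n + 1 - h) / 2) + closedGF n h k := by
    cases h with
    | zero =>
      rw [wordGF_succ_zero, ih n (by omega) (by omega), qBinomialProd_comm]
      congr 2
    | succ h =>
      rw [wordGF_succ_succ, ih n (by omega) (by omega)]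
      congr 2
      omega
  rw [hstep]
  rcases Nat.lt_or_ge h n with hlt | hge
  · obtain ⟨n, rfl⟩ := Nat.exists_eq_add_of_lt (Nat.zero_lt_of_lt hlt)
    rw [zero_add] at *
    obtain ⟨a, ha⟩ : ∃ a, a = (n + h + 1) / 2 := ⟨_, rfl⟩
    obtain ⟨b, hb⟩ : ∃ b, b = (n - h) / 2 := ⟨_, rfl⟩
    -- This identifies the weight `q^(n+1)` of the new peak with `q^(a+b+1)` in
    -- `qBinomialProd_succ`.
    have hab : a + b = n := by omega
    rw [show (n + 1 + h) / 2 = a by omega, show (n + 1 + 1 - h) / 2 = b + 1 by omega,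
      show (n + 1 + 1 + h + 1) / 2 = a + 1 by omega]
    cases k with
    | zero =>
      rw [closedGF_succ_zero, ih (n + 1) (by omega) (by omega), ih n (by omega) (by omega)]
      simp [qBinomialProd_zero]
    | succ k =>
      rw [closedGF_succ_succ, ih (n + 1) (by omega) (by omega), ih n (by omega) (by omega),
        ih n (by omega) (by omega), qBinomialProd_succ, ← ha, ← hb, hab,
        show (n + 1 + (h + 1) + 1) / 2 = a + 1 by omega, show (n + 1 - (h + 1)) / 2 = b by omega]
  · rw [closedGF_of_le hge, add_zero, show (n + 1 - h) / 2 = 0 by omega]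
    exact qBinomialProd_zero_right _ _ _

/-! ### Words of functions -/

theorem cases_letter (x : SignType) : x = 0 ∨ x = -1 ∨ x = 1 := by
  cases x <;> decide

/-- The word of the first `n` values of `f`, last letter first. -/
def wordOf (f : ℕ → SignType) : ℕ → List SignType
  | 0 => []
  | n + 1 => f n :: wordOf f n

theorem length_wordOf (f : ℕ → SignType) (n : ℕ) : (wordOf f n).length = n := by
  induction n with
  | zero => rfl
  | succ n ih => rw [wordOf, List.length_cons, ih]

theorem wordOf_congr {f g : ℕ → SignType} {n : ℕ} :
    wordOf f n = wordOf g n ↔ ∀ i < n, f i = g i := by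
  induction n with
  | zero => simp [wordOf]
  | succ n ih =>
    rw [wordOf, wordOf, List.cons.injEq, ih]
    constructor
    · rintro ⟨h1, h2⟩ i hi
      rcases Nat.lt_succ_iff_lt_or_eq.1 hi with h | rfl
      exacts [h2 i h, h1]
    · exact fun h => ⟨h n (by omega), fun i hi => h i (by omega)⟩

theorem exists_wordOf_eq (w : List SignType) : ∃ f, wordOf f w.length = w := by
  induction w with
  | nil => exact ⟨fun _ => 0, rfl⟩
  | cons x w ih =>
    obtain ⟨f, hf⟩ := ih
    refine ⟨Function.update f w.length x, ?_⟩
    rw [List.length_cons, wordOf, Function.update_self]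
    congr 1
    rw [← hf, length_wordOf, wordOf_congr]
    exact fun i hi => Function.update_of_ne hi.ne _ _

/-- The first `n` values of `f` form a word that never goes below height `0` and has zeros only at
height `0`. -/
def IsBallot (f : ℕ → SignType) (n : ℕ) : Prop :=
  (∀ i ≤ n, Nat.count (f · = -1) i ≤ Nat.count (f · = 1) i) ∧
    ∀ i < n, f i = 0 → Nat.count (f · = 1) i = Nat.count (f · = -1) i

theorem isBallot_succ {f : ℕ → SignType} {n : ℕ} :
    IsBallot f (n + 1) ↔ IsBallot f n ∧
      Nat.count (f · = -1) (n + 1) ≤ Nat.count (f · = 1) (n + 1) ∧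
      (f n = 0 → Nat.count (f · = 1) n = Nat.count (f · = -1) n) := by
  constructor
  · rintro ⟨h1, h2⟩
    exact ⟨⟨fun i hi => h1 i (by omega), fun i hi => h2 i (by omega)⟩, h1 _ le_rfl,
      h2 n (by omega)⟩
  · rintro ⟨⟨h1, h2⟩, h3, h4⟩
    refine ⟨fun i hi => ?_, fun i hi => ?_⟩
    · rcases Nat.lt_or_eq_of_le hi with h | rfl
      exacts [h1 i (by omega), h3]
    · rcases Nat.lt_succ_iff_lt_or_eq.1 hi with h | rfl
      exacts [h2 i h, h4]

theorem wordOf_mem_words {f : ℕ → SignType} {n h : ℕ} :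
    wordOf f n ∈ words n h ↔
      IsBallot f n ∧ Nat.count (f · = 1) n = Nat.count (f · = -1) n + h := by
  induction n generalizing h with
  | zero => cases h <;> simp [wordOf, words, IsBallot]
  | succ n ih =>
    have hn : IsBallot f n → Nat.count (f · = -1) n ≤ Nat.count (f · = 1) n :=
      fun hb => hb.1 n le_rfl
    rw [isBallot_succ, Nat.count_succ, Nat.count_succ]
    generalize Nat.count (f · = 1) n = u at *
    generalize Nat.count (f · = -1) n = d at *
    have key : wordOf f (n + 1) ∈ words (n + 1) h ↔
        (f n = -1 ∧ wordOf f n ∈ words n (h + 1)) ∨ (f n = 0 ∧ h = 0 ∧ wordOf f n ∈ words n 0) ∨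
          ∃ h', h = h' + 1 ∧ f n = 1 ∧ wordOf f n ∈ words n h' := by
      cases h <;> simp [words, wordOf, eq_comm, and_comm]
    rw [key]
    simp only [ih]
    rcases cases_letter (f n) with h3 | h3 | h3 <;> rw [h3]
    · simp
      grind
    · simp
      grind
    · simp only [reduceCtorEq, false_and, false_or, true_and, if_true, if_false]
      constructor
      · rintro ⟨h', rfl, hb, h⟩
        simp [hb, h]
        omega
      · simp
        intro hb _ h
        have := hn hb
        -- The height before the final opener; the ballot condition makes the subtraction exact.
        exact ⟨u - d, by omega, hb, by omega⟩

/-- The positions of the peaks among the first `n` values of `f`. -/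
def peakSet (f : ℕ → SignType) (n : ℕ) : Finset ℕ :=
  (Finset.Ico 1 n).filter fun i => f (i - 1) = 1 ∧ f i = -1

theorem peakSet_succ (f : ℕ → SignType) (n : ℕ) :
    peakSet f (n + 1) =
      if f n = -1 ∧ (wordOf f n).head? = some 1 then insert n (peakSet f n) else peakSet f n := by
  cases n with
  | zero => simp [peakSet, wordOf]
  | succ n =>
    rw [peakSet, ← Finset.insert_Ico_right_eq_Ico_add_one (by omega), Finset.filter_insert]
    simp [wordOf, peakSet, and_comm]

theorem notMem_peakSet (f : ℕ → SignType) (n : ℕ) : n ∉ peakSet f n := by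
  simp [peakSet]

theorem wordDes_wordOf (f : ℕ → SignType) (n : ℕ) :
    wordDes (wordOf f n) = (peakSet f n).card := by
  induction n with
  | zero => simp [wordOf, wordDes, peakSet]
  | succ n ih =>
    rw [wordOf, wordDes, ih, peakSet_succ]
    split_ifs
    · rw [Finset.card_insert_of_notMem (notMem_peakSet f n)]
    · rfl

theorem wordMaj_wordOf (f : ℕ → SignType) (n : ℕ) :
    wordMaj (wordOf f n) = ∑ i ∈ peakSet f n, i := by
  induction n with
  | zero => simp [wordOf, wordMaj, peakSet]
  | succ n ih =>
    rw [wordOf, wordMaj, ih, peakSet_succ, length_wordOf]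
    split_ifs
    · rw [Finset.sum_insert (notMem_peakSet f n), add_comm]
    · rfl


/-! ### Involutions -/

/-- The sign of `ρ i - i`: `1` at openers, `-1` at closers and `0` at fixed points. -/
noncomputable def rise (ρ : ℕ → ℕ) (i : ℕ) : SignType := SignType.sign ((ρ i : ℤ) - i)

theorem rise_eq_one {ρ : ℕ → ℕ} {i : ℕ} : rise ρ i = 1 ↔ i < ρ i := by
  rw [rise, sign_eq_one_iff]
  omega

theorem rise_eq_neg_one {ρ : ℕ → ℕ} {i : ℕ} : rise ρ i = -1 ↔ ρ i < i := by
  rw [rise, sign_eq_neg_one_iff]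
  omega

theorem rise_eq_zero {ρ : ℕ → ℕ} {i : ℕ} : rise ρ i = 0 ↔ ρ i = i := by
  rw [rise, sign_eq_zero_iff]
  omega

/-- `ρ` restricts to a `321`-avoiding involution of `{0, …, n - 1}`. -/
structure IsInvolution321 (ρ : ℕ → ℕ) (n : ℕ) : Prop where
  invol : ∀ i < n, ρ (ρ i) = i
  lt : ∀ i < n, ρ i < n
  avoids : ∀ i j l, i < j → j < l → l < n → ρ j < ρ i → ρ l < ρ j → False

namespace IsInvolution321

variable {ρ : ℕ → ℕ} {n : ℕ} (hρ : IsInvolution321 ρ n)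

include hρ

theorem count_closers_le {i : ℕ} (hi : i ≤ n) :
    Nat.count (rise ρ · = -1) i ≤ Nat.count (rise ρ · = 1) i := by
  rw [Nat.count_eq_card_filter_range, Nat.count_eq_card_filter_range]
  refine Finset.card_le_card_of_injOn ρ ?_ ?_
  · intro a ha
    simp only [Finset.coe_filter, Finset.mem_range, Set.mem_ofPred_eq, rise_eq_one,
      rise_eq_neg_one] at ha ⊢
    rw [hρ.invol a (by omega)]
    omega
  · intro a ha b hb hab
    simp only [Finset.coe_filter, Finset.mem_range, Set.mem_ofPred_eq] at ha hb
    rw [← hρ.invol a (by omega), hab, hρ.invol b (by omega)]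

theorem count_openers_le {i : ℕ} (hi : i ≤ n) (h : ∀ a < i, ρ a < i) :
    Nat.count (rise ρ · = 1) i ≤ Nat.count (rise ρ · = -1) i := by
  rw [Nat.count_eq_card_filter_range, Nat.count_eq_card_filter_range]
  refine Finset.card_le_card_of_injOn ρ ?_ ?_
  · intro a ha
    simp only [Finset.coe_filter, Finset.mem_range, Set.mem_ofPred_eq, rise_eq_one,
      rise_eq_neg_one] at ha ⊢
    rw [hρ.invol a (by omega)]
    exact ⟨h a ha.1, ha.2⟩
  · intro a ha b hb hab
    simp only [Finset.coe_filter, Finset.mem_range, Set.mem_ofPred_eq] at ha hb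
    rw [← hρ.invol a (by omega), hab, hρ.invol b (by omega)]

theorem eq_of_apply_eq {a b : ℕ} (ha : a < n) (hb : b < n) (h : ρ a = ρ b) : a = b := by
  rw [← hρ.invol a ha, h, hρ.invol b hb]

theorem isBallot : IsBallot (rise ρ) n := by
  refine ⟨fun i hi => hρ.count_closers_le hi, fun i hi h0 => ?_⟩
  rw [rise_eq_zero] at h0
  refine le_antisymm (hρ.count_openers_le hi.le fun a ha => ?_) (hρ.count_closers_le hi.le)
  by_contra! hc
  have h1 : ρ a ≠ i := fun h => by
    have := hρ.eq_of_apply_eq (ha.trans hi) hi (h.trans h0.symm)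
    omega
  have h2 := hρ.invol a (by omega)
  -- An arc over the fixed point `i` gives the values `ρ a > i > a` at `a < i < ρ a`.
  exact hρ.avoids a i (ρ a) ha (by omega) (hρ.lt a (by omega)) (by omega) (by omega)

theorem count_eq :
    Nat.count (rise ρ · = 1) n = Nat.count (rise ρ · = -1) n :=
  le_antisymm (hρ.count_openers_le le_rfl hρ.lt) (hρ.count_closers_le le_rfl)

/-- Openers and closers are matched in order. -/
theorem count_apply {i : ℕ} (hi : i < n) (h : i < ρ i) :
    Nat.count (rise ρ · = -1) (ρ i) = Nat.count (rise ρ · = 1) i := by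
  have hlt := hρ.lt i hi
  have hii := hρ.invol i hi
  rw [Nat.count_eq_card_filter_range, Nat.count_eq_card_filter_range]
  apply le_antisymm
  · refine Finset.card_le_card_of_injOn ρ ?_ ?_
    · intro a ha
      simp only [Finset.coe_filter, Finset.mem_range, Set.mem_ofPred_eq, rise_eq_one,
        rise_eq_neg_one] at ha ⊢
      have haa := hρ.invol a (by omega)
      refine ⟨?_, by omega⟩
      by_contra! hc
      have h1 : ρ a ≠ i := fun h => by
        have := hρ.eq_of_apply_eq (by omega) hlt (h.trans hii.symm)
        omega
      -- The arc of `a` would be nested inside that of `i`: `i < ρ a < a < ρ i`.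
      exact hρ.avoids i (ρ a) a (by omega) ha.2 (by omega) (by omega) (by omega)
    · intro a ha b hb hab
      simp only [Finset.coe_filter, Finset.mem_range, Set.mem_ofPred_eq] at ha hb
      exact hρ.eq_of_apply_eq (by omega) (by omega) hab
  · refine Finset.card_le_card_of_injOn ρ ?_ ?_
    · intro a ha
      simp only [Finset.coe_filter, Finset.mem_range, Set.mem_ofPred_eq, rise_eq_one,
        rise_eq_neg_one] at ha ⊢
      have haa := hρ.invol a (by omega)
      refine ⟨?_, by omega⟩
      by_contra! hc
      have h1 : ρ a ≠ ρ i := fun h => by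
        have := hρ.eq_of_apply_eq (by omega) hi h
        omega
      -- Here the nesting is the other way round: `a < i < ρ i < ρ a`.
      exact hρ.avoids a i (ρ i) ha.1 h hlt (by omega) (by omega)
    · intro a ha b hb hab
      simp only [Finset.coe_filter, Finset.mem_range, Set.mem_ofPred_eq] at ha hb
      exact hρ.eq_of_apply_eq (by omega) (by omega) hab

end IsInvolution321

/-! ### Recovering the involution from its word -/

/-- The involution which matches the openers and the closers of `f` in order. -/
noncomputable def partner (f : ℕ → SignType) (i : ℕ) : ℕ :=
  if f i = 1 then Nat.nth (f · = -1) (Nat.count (f · = 1) i)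
  else if f i = -1 then Nat.nth (f · = 1) (Nat.count (f · = -1) i)
  else i

theorem IsInvolution321.eq_partner {ρ : ℕ → ℕ} {n : ℕ} (hρ : IsInvolution321 ρ n) {i : ℕ}
    (hi : i < n) : ρ i = partner (rise ρ) i := by
  have hii := hρ.invol i hi
  unfold partner
  split_ifs with h1 h2
  · rw [rise_eq_one] at h1
    rw [← hρ.count_apply hi h1, Nat.nth_count (p := (rise ρ · = -1))]
    rw [rise_eq_neg_one]
    omega
  · rw [rise_eq_neg_one] at h2
    have h := hρ.count_apply (hρ.lt i hi) (by omega)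
    rw [hii] at h
    rw [h, Nat.nth_count (p := (rise ρ · = 1))]
    rw [rise_eq_one]
    omega
  · rw [rise_eq_one] at h1
    rw [rise_eq_neg_one] at h2
    omega

/-- The bound guarantees that the `t`-th element exists, so `Nat.nth` does not take its default
value `0`. -/
theorem nth_spec {p : ℕ → Prop} [DecidablePred p] {t m : ℕ} (h : t < Nat.count p m) :
    p (Nat.nth p t) ∧ Nat.count p (Nat.nth p t) = t ∧ Nat.nth p t < m := by
  have hf : ∀ hf : (Set.ofPred p).Finite, t < hf.toFinset.card :=
    fun hf => h.trans_le (Nat.count_le_card hf m)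
  exact ⟨Nat.nth_mem _ hf, Nat.count_nth hf, Nat.nth_lt_of_lt_count h⟩

section Partner

variable {f : ℕ → SignType} {n : ℕ} (hf : IsBallot f n)
  (hn : Nat.count (f · = 1) n = Nat.count (f · = -1) n)

include hf

include hn in
theorem partner_opener {i : ℕ} (hi : i < n) (h : f i = 1) :
    f (partner f i) = -1 ∧ Nat.count (f · = -1) (partner f i) = Nat.count (f · = 1) i ∧
      partner f i < n ∧ i < partner f i := by
  have h1 : Nat.count (f · = 1) i < Nat.count (f · = -1) n :=
    hn ▸ Nat.count_strict_mono (p := (f · = 1)) h hi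
  have h2 : partner f i = Nat.nth (f · = -1) (Nat.count (f · = 1) i) := if_pos h
  obtain ⟨h3, h4, h5⟩ := nth_spec h1
  rw [← h2] at h3 h4 h5
  refine ⟨h3, h4, h5, ?_⟩
  -- If the matching closer came before `i`, the prefix ending with it would hold more closers than
  -- openers.
  by_contra! hc
  have h6 := Nat.count_succ (f · = -1) (partner f i)
  rw [if_pos h3, h4] at h6
  have h7 : partner f i ≠ i := fun h' => by
    rw [h', h] at h3
    exact absurd h3 (by decide)
  have h8 := hf.1 (partner f i + 1) (by omega)
  have h9 := Nat.count_monotone (f · = 1) (show partner f i + 1 ≤ i by omega)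
  omega

theorem partner_closer {i : ℕ} (hi : i < n) (h : f i = -1) :
    f (partner f i) = 1 ∧ Nat.count (f · = 1) (partner f i) = Nat.count (f · = -1) i ∧
      partner f i < i := by
  have h1 := hf.1 (i + 1) hi
  have hne : f i ≠ 1 := by rw [h]; decide
  rw [Nat.count_succ, Nat.count_succ, if_pos h, if_neg hne] at h1
  have h2 : partner f i = Nat.nth (f · = 1) (Nat.count (f · = -1) i) := by
    rw [partner, if_neg hne, if_pos h]
  rw [h2]
  exact nth_spec (p := (f · = 1)) (m := i) (by omega)

omit hf in
theorem partner_zero {i : ℕ} (h : f i = 0) : partner f i = i := by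
  simp [partner, h]

include hn

theorem partner_lt {i : ℕ} (hi : i < n) : partner f i < n := by
  rcases cases_letter (f i) with h | h | h
  · rwa [partner_zero h]
  · exact (partner_closer hf hi h).2.2.trans hi
  · exact (partner_opener hf hn hi h).2.2.1

theorem partner_partner {i : ℕ} (hi : i < n) : partner f (partner f i) = i := by
  rcases cases_letter (f i) with h | h | h
  · rw [partner_zero h, partner_zero h]
  · obtain ⟨h1, h2, -⟩ := partner_closer hf hi h
    rw [partner, if_pos h1, h2]
    exact Nat.nth_count (p := (f · = -1)) h
  · obtain ⟨h1, h2, -⟩ := partner_opener hf hn hi h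
    rw [partner, if_neg (by rw [h1]; decide), if_pos h1, h2]
    exact Nat.nth_count (p := (f · = 1)) h

theorem rise_partner {i : ℕ} (hi : i < n) : rise (partner f) i = f i := by
  rcases cases_letter (f i) with h | h | h
  · rw [h, rise_eq_zero, partner_zero h]
  · rw [h, rise_eq_neg_one]
    exact (partner_closer hf hi h).2.2
  · rw [h, rise_eq_one]
    exact (partner_opener hf hn hi h).2.2.2

theorem eq_one_of_lt_partner {i : ℕ} (hi : i < n) (h : i < partner f i) : f i = 1 := by
  rwa [← rise_partner hf hn hi, rise_eq_one]

theorem eq_neg_one_of_partner_lt {i : ℕ} (hi : i < n) (h : partner f i < i) : f i = -1 := by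
  rwa [← rise_partner hf hn hi, rise_eq_neg_one]

theorem isInvolution321_partner : IsInvolution321 (partner f) n := by
  refine ⟨fun i hi => partner_partner hf hn hi, fun i hi => partner_lt hf hn hi, ?_⟩
  intro i j l hij hjl hl h1 h2
  have hj : j < n := hjl.trans hl
  have hi : i < n := hij.trans hj
  -- A fixed middle entry would lie under the arc of `i`, at positive height. A middle closer makes
  -- `l` a closer and a middle opener makes `i` an opener; then two arcs would be matched out of
  -- order.
  rcases cases_letter (f j) with h | h | h
  · have hp := partner_zero h
    have hfi := eq_one_of_lt_partner hf hn hi (by omega)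
    obtain ⟨-, h4, -⟩ := partner_opener hf hn hi hfi
    have h5 := Nat.count_monotone (f · = -1) (show j ≤ partner f i by omega)
    have h6 := Nat.count_strict_mono (p := (f · = 1)) hfi hij
    have h7 := hf.2 j hj h
    omega
  · have hp := (partner_closer hf hj h).2.2
    have hfl := eq_neg_one_of_partner_lt hf hn hl (by omega)
    obtain ⟨-, h3, -⟩ := partner_closer hf hj h
    obtain ⟨-, h4, -⟩ := partner_closer hf hl hfl
    have h5 := Nat.count_monotone (f · = 1) h2.le
    have h6 := Nat.count_strict_mono (p := (f · = -1)) h hjl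
    omega
  · have hp := (partner_opener hf hn hj h).2.2.2
    have hfi := eq_one_of_lt_partner hf hn hi (by omega)
    obtain ⟨-, h3, -⟩ := partner_opener hf hn hj h
    obtain ⟨-, h4, -⟩ := partner_opener hf hn hi hfi
    have h5 := Nat.count_monotone (f · = -1) h1.le
    have h6 := Nat.count_strict_mono (p := (f · = 1)) hfi hij
    omega

end Partner

/-! ### Permutations -/

/-- The extension of a permutation of `{0, …, n - 1}` to the natural numbers. -/
def extend {n : ℕ} (π : Equiv.Perm (Fin n)) (i : ℕ) : ℕ :=
  if h : i < n then π ⟨i, h⟩ else i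

theorem extend_of_lt {n : ℕ} (π : Equiv.Perm (Fin n)) {i : ℕ} (h : i < n) :
    extend π i = π ⟨i, h⟩ :=
  dif_pos h

theorem extend_coe {n : ℕ} (π : Equiv.Perm (Fin n)) (i : Fin n) : extend π i = π i :=
  extend_of_lt π i.2

theorem isInvolution321_extend {n : ℕ} {π : Equiv.Perm (Fin n)} :
    IsInvolution321 (extend π) n ↔ π ∈ involutions321 n := by
  rw [involutions321, Finset.mem_filter]
  constructor
  · intro h
    refine ⟨Finset.mem_univ _, eq_inv_of_mul_eq_one_left (Equiv.ext fun i => Fin.ext ?_), ?_⟩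
    · have := h.invol i i.2
      rwa [extend_coe, extend_coe] at this
    · rintro ⟨i, j, l, hij, hjl, h1, h2⟩
      refine h.avoids i j l hij hjl l.2 ?_ ?_ <;> rw [extend_coe, extend_coe]
      exacts [h1, h2]
  · rintro ⟨-, hinv, hav⟩
    refine ⟨fun i hi => ?_, fun i hi => ?_, fun i j l hij hjl hl h1 h2 => hav ?_⟩
    · rw [extend_of_lt π hi, extend_coe]
      nth_rw 1 [hinv]
      simp
    · rw [extend_of_lt π hi]
      exact Fin.is_lt _
    · have hj := hjl.trans hl
      have hi := hij.trans hj
      rw [extend_of_lt π hj] at h1 h2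
      rw [extend_of_lt π hi] at h1
      rw [extend_of_lt π hl] at h2
      exact ⟨⟨i, hi⟩, ⟨j, hj⟩, ⟨l, hl⟩, hij, hjl, h1, h2⟩

theorem IsInvolution321.exists_perm {ρ : ℕ → ℕ} {n : ℕ} (hρ : IsInvolution321 ρ n) :
    ∃ π ∈ involutions321 n, ∀ i < n, extend π i = ρ i := by
  let g : Fin n → Fin n := fun i => ⟨ρ i, hρ.lt i i.2⟩
  have hg : Function.Involutive g := fun i => Fin.ext (hρ.invol i i.2)
  have he : ∀ i < n, extend hg.toPerm i = ρ i := fun i hi => by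
    rw [extend_of_lt _ hi]
    rfl
  refine ⟨hg.toPerm, isInvolution321_extend.1 ⟨fun i hi => ?_, fun i hi => ?_, ?_⟩, he⟩
  · rw [he i hi, he _ (hρ.lt i hi), hρ.invol i hi]
  · rw [he i hi]
    exact hρ.lt i hi
  · intro i j l hij hjl hl h1 h2
    rw [he j (by omega)] at h1 h2
    rw [he i (by omega)] at h1
    rw [he l (by omega)] at h2
    exact hρ.avoids i j l hij hjl hl h1 h2

/-- In a `321`-avoiding involution, the descents are the positions where an opener is followed by
a closer. -/
theorem IsInvolution321.apply_lt_iff {ρ : ℕ → ℕ} {n : ℕ} (hρ : IsInvolution321 ρ n) {i : ℕ}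
    (hi : i + 1 < n) : ρ (i + 1) < ρ i ↔ rise ρ i = 1 ∧ rise ρ (i + 1) = -1 := by
  rw [rise_eq_one, rise_eq_neg_one]
  constructor
  · intro h
    have h1 := hρ.lt i (by omega)
    have h2 := hρ.invol i (by omega)
    have h3 := hρ.invol (i + 1) hi
    have h4 := hρ.lt (i + 1) hi
    constructor
    -- In each case the 321 pattern lies among `i`, `i + 1` and their images.
    · by_contra! hc
      rcases hc.eq_or_lt with he | hlt
      · exact hρ.avoids (ρ (i + 1)) i (i + 1) (by omega) (by omega) hi (by omega) h
      · exact hρ.avoids (ρ (i + 1)) (ρ i) i h hlt (by omega) (by omega) (by omega)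
    · by_contra! hc
      rcases hc.eq_or_lt with he | hlt
      · exact hρ.avoids i (i + 1) (ρ i) (by omega) (by omega) h1 h (by omega)
      · exact hρ.avoids (i + 1) (ρ (i + 1)) (ρ i) hlt h h1 (by omega) (by omega)
  · omega

theorem descentSet_eq_peakSet {n : ℕ} {π : Equiv.Perm (Fin n)} (hπ : π ∈ involutions321 n) :
    descentSet π = peakSet (rise (extend π)) n := by
  have hρ := isInvolution321_extend.2 hπ
  refine Finset.filter_congr fun i hi => ?_
  rw [Finset.mem_Ico] at hi
  obtain ⟨i, rfl⟩ := Nat.exists_eq_add_of_le' hi.1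
  rw [Nat.add_sub_cancel, ← hρ.apply_lt_iff hi.2, extend_of_lt π hi.2,
    extend_of_lt π (show i < n by omega)]
  constructor
  · rintro ⟨a, b, ha, hb, h⟩
    have ha' : a = ⟨i, Nat.lt_of_succ_lt hi.2⟩ := Fin.ext (by simpa using ha)
    have hb' : b = ⟨i + 1, hi.2⟩ := Fin.ext hb
    rwa [ha', hb'] at h
  · exact fun h => ⟨_, _, rfl, rfl, h⟩

theorem rise_extend_of_le {n : ℕ} (π : Equiv.Perm (Fin n)) {i : ℕ} (h : n ≤ i) :
    rise (extend π) i = 0 := by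
  rw [rise_eq_zero, extend, dif_neg (by omega)]

theorem sum_involutions321_eq_wordGF (n k : ℕ) :
    ∑ π ∈ involutions321 n with des π = k, (RatFunc.X : RatFunc ℚ) ^ maj π = wordGF n 0 k := by
  rw [Finset.sum_filter, wordGF]
  refine Finset.sum_bij (fun π _ => wordOf (rise (extend π)) n) ?_ ?_ ?_ ?_
  · intro π hπ
    have hρ := isInvolution321_extend.2 hπ
    exact wordOf_mem_words.2 ⟨hρ.isBallot, hρ.count_eq⟩
  · intro π hπ σ hσ h
    rw [wordOf_congr] at h
    have hρ := isInvolution321_extend.2 hπ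
    have hτ := isInvolution321_extend.2 hσ
    -- `partner` reads the whole sequence, so agreement beyond `n` is needed too; `extend` is the
    -- identity there.
    have h0 : rise (extend π) = rise (extend σ) := by
      funext i
      rcases Nat.lt_or_ge i n with hi | hi
      · exact h i hi
      · rw [rise_extend_of_le π hi, rise_extend_of_le σ hi]
    refine Equiv.ext fun i => Fin.ext ?_
    rw [← extend_coe, ← extend_coe, hρ.eq_partner i.2, hτ.eq_partner i.2, h0]
  · intro w hw
    obtain ⟨f, hf⟩ := exists_wordOf_eq w
    rw [length_of_mem_words hw] at hf
    rw [← hf] at hw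
    obtain ⟨hb, hn⟩ := wordOf_mem_words.1 hw
    obtain ⟨π, hπ, he⟩ := (isInvolution321_partner hb hn).exists_perm
    refine ⟨π, hπ, ?_⟩
    rw [← hf, wordOf_congr]
    intro i hi
    rw [rise, he i hi]
    exact rise_partner hb hn hi
  · intro π hπ
    rw [wordWeight, wordDes_wordOf, wordMaj_wordOf, ← descentSet_eq_peakSet hπ]
    rfl

end PermStat

theorem mainTheorem4 (n k : ℕ) (hk : k < n) :
    ∑ π ∈ PermStat.involutions321 n with PermStat.des π = k,
        (RatFunc.X : RatFunc ℚ) ^ PermStat.maj π =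
      RatFunc.X ^ (k ^ 2) * PermStat.qBinomial ⌈(n : ℚ) / 2⌉₊ k *
        PermStat.qBinomial ⌊(n : ℚ) / 2⌋₊ k := by
  have hf : ⌊(n : ℚ) / 2⌋₊ = n / 2 := by
    exact_mod_cast Nat.floor_div_eq_div (K := ℚ) n 2
  have hc : ⌈(n : ℚ) / 2⌉₊ = (n + 1) / 2 := by
    have h1 : 2 * ((n + 1) / 2) ≤ n + 1 := by omega
    have h2 : n ≤ 2 * ((n + 1) / 2) := by omega
    have h1' : (2 * ((n + 1) / 2 : ℕ) : ℚ) ≤ n + 1 := by exact_mod_cast h1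
    have h2' : (n : ℚ) ≤ 2 * ((n + 1) / 2 : ℕ) := by exact_mod_cast h2
    -- `Nat.ceil_eq_iff` needs a nonzero value, and `k < n` makes `n` positive.
    rw [Nat.ceil_eq_iff (by omega), Nat.cast_sub (by omega)]
    constructor
    · push_cast at *
      linarith
    · linarith
  rw [PermStat.sum_involutions321_eq_wordGF, PermStat.wordGF_eq n.zero_le, hf, hc]
  rfl
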